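/- Let $G$ be a finite group. Its Burnside ring $B(G)$ is the Grothendieck ring of the semiring of isomorphism classes of finite $G$-sets under disjoint union and Cartesian product; $[X]$ is the class of a finite $G$-set $X$. For a subgroup $K\le G$ let $\varphi^G_K\colon B(G)\to\mathbb Z$ be the ring homomorphism with $\varphi^G_K([X])=\#\{x\in X\mid kx=x\text{ for all }k\in K\}$. Let $\mathrm{Nsub}(G)$ be the set of normal subgroups of $G$, and let $B(G,\mathrm{Nsub}(G))$ be the subring of $B(G)$ spanned over $\mathbb Z$ by the elements $[G/N]$ with $N\in\mathrm{Nsub}(G)$. The group $G$ is called $2$-seminilpotent if for every subgroup $K\le G$ of even index there is a normal subgroup $N$ of $G$ with $K\le N$ and $|G:N|=2$, and the number of such $N$ is odd. Theorem. Let $G$ be a $2$-seminilpotent finite group of even order $n$, and let $C$ be a cyclic group of order $n$. There is a unique ring homomorphism $\alpha\colon B(C)\to B(G)$ (the Frobenius–Wielandt homomorphism) such that $\varphi^G_K(\alpha(x))=\varphi^C_{C_{|K|}}(x)$ for all $x\in B(C)$ and all subgroups $K\le G$, where $C_{|K|}$ is the subgroup of $C$ of order $|K|$. It satisfies \[ \alpha(B(C)^\times)\subseteq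 B(G,\mathrm{Nsub}(G))^\times . \] Moreover, with $u_N=1-[G/N]$, the product $\prod_{N\le G,\ |G:N|=2}u_N$ is a unit of $B(G)$, and \[ \alpha(B(C)^\times)=\Bigl\langle -1,\ \prod_{N\le G,\ |G:N|=2}u_N\Bigr\rangle . \] -/

import Mathlib

open Algebra

universe u v

noncomputable section

/-! ### The Grothendieck ring of a commutative semiring -/

/-- The Grothendieck ring of a commutative semiring `S`: the Grothendieck group of `(S, +)`
(formal differences), with the biadditive extension of the multiplication of `S`. -/
def GrothendieckRing (S : Type u) [CommSemiring S] : Type u := GrothendieckAddGroup S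

namespace GrothendieckRing

variable {S : Type u} [CommSemiring S]

instance : AddCommGroup (GrothendieckRing S) :=
  inferInstanceAs (AddCommGroup (GrothendieckAddGroup S))

/-- The canonical additive map `S → GrothendieckRing S`. -/
def ofAdd : S →+ GrothendieckRing S := (GrothendieckAddGroup.of : S →+ GrothendieckAddGroup S)

/-- Extension of an additive map to an abelian group. -/
def liftAdd {A : Type v} [AddCommGroup A] (f : S →+ A) : GrothendieckRing S →+ A :=
  (GrothendieckAddGroup.lift f : GrothendieckAddGroup S →+ A)

theorem liftAdd_ofAdd {A : Type v} [AddCommGroup A] (f : S →+ A) (a : S) :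
    liftAdd f (ofAdd a) = f a :=
  DFunLike.congr_fun (GrothendieckAddGroup.lift.symm_apply_apply f) a

theorem exists_sub (x : GrothendieckRing S) : ∃ a b : S, x = ofAdd a - ofAdd b := by
  obtain ⟨⟨a, b⟩, h⟩ := (AddLocalization.addMonoidOf (⊤ : AddSubmonoid S)).surj x
  exact ⟨a, b, eq_sub_of_add_eq h⟩

/-- The multiplication, as a biadditive map. -/
def mulHom : GrothendieckRing S →+ GrothendieckRing S →+ GrothendieckRing S :=
  liftAdd
    { toFun := fun a => liftAdd (ofAdd.comp (AddMonoidHom.mulLeft a))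
      map_zero' := by
        ext x
        obtain ⟨b, c, rfl⟩ := exists_sub x
        simp [liftAdd_ofAdd]
      map_add' := fun a a' => by
        ext x
        obtain ⟨b, c, rfl⟩ := exists_sub x
        simp only [map_sub, liftAdd_ofAdd, AddMonoidHom.add_apply, AddMonoidHom.comp_apply,
          AddMonoidHom.coe_mulLeft, add_mul, map_add] }

instance : Mul (GrothendieckRing S) := ⟨fun x y => mulHom x y⟩

instance : One (GrothendieckRing S) := ⟨ofAdd 1⟩

theorem ofAdd_mul (a b : S) : (ofAdd (a * b) : GrothendieckRing S) = ofAdd a * ofAdd b := by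
  change _ = mulHom (ofAdd a) (ofAdd b)
  simp [mulHom, liftAdd_ofAdd]

instance : NonUnitalNonAssocRing (GrothendieckRing S) :=
  { (inferInstance : AddCommGroup (GrothendieckRing S)),
    (inferInstance : Mul (GrothendieckRing S)) with
    left_distrib := fun x y z => map_add (mulHom x) y z
    right_distrib := fun x y z => by
      change mulHom (x + y) z = mulHom x z + mulHom y z
      rw [map_add, AddMonoidHom.add_apply]
    zero_mul := fun x => by
      change mulHom 0 x = 0
      rw [map_zero, AddMonoidHom.zero_apply]
    mul_zero := fun x => map_zero (mulHom x) }

theorem one_def : (1 : GrothendieckRing S) = ofAdd 1 := rfl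

instance : CommRing (GrothendieckRing S) :=
  { (inferInstance : NonUnitalNonAssocRing (GrothendieckRing S)),
    (inferInstance : One (GrothendieckRing S)) with
    mul_assoc := fun x y z => by
      obtain ⟨a, a', rfl⟩ := exists_sub x
      obtain ⟨b, b', rfl⟩ := exists_sub y
      obtain ⟨c, c', rfl⟩ := exists_sub z
      simp only [sub_mul, mul_sub, ← ofAdd_mul, mul_assoc]
    one_mul := fun x => by
      obtain ⟨a, a', rfl⟩ := exists_sub x
      rw [one_def, mul_sub, ← ofAdd_mul, ← ofAdd_mul, one_mul, one_mul]
    mul_one := fun x => by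
      obtain ⟨a, a', rfl⟩ := exists_sub x
      rw [one_def, sub_mul, ← ofAdd_mul, ← ofAdd_mul, mul_one, mul_one]
    mul_comm := fun x y => by
      obtain ⟨a, a', rfl⟩ := exists_sub x
      obtain ⟨b, b', rfl⟩ := exists_sub y
      simp only [sub_mul, mul_sub, ← ofAdd_mul]
      rw [mul_comm a b, mul_comm a b', mul_comm a' b, mul_comm a' b']
      abel }

/-- The canonical semiring homomorphism `S → GrothendieckRing S`. -/
def of : S →+* GrothendieckRing S :=
  { (ofAdd : S →+ GrothendieckRing S) with
    map_one' := rfl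
    map_mul' := ofAdd_mul }

/-- Extension of a semiring homomorphism to a commutative ring. -/
def lift {R : Type v} [CommRing R] (f : S →+* R) : GrothendieckRing S →+* R :=
  { liftAdd f.toAddMonoidHom with
    map_one' := (liftAdd_ofAdd f.toAddMonoidHom 1).trans (map_one f)
    map_mul' := fun x y => by
      change liftAdd f.toAddMonoidHom (x * y) =
        liftAdd f.toAddMonoidHom x * liftAdd f.toAddMonoidHom y
      obtain ⟨a, a', rfl⟩ := exists_sub x
      obtain ⟨b, b', rfl⟩ := exists_sub y
      simp only [sub_mul, mul_sub, ← ofAdd_mul, map_sub, liftAdd_ofAdd]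
      simp }

end GrothendieckRing

/-! ### Finite `G`-sets and the Burnside ring -/

/-- A finite (left) `G`-set. -/
structure FinGSet (G : Type u) [Group G] where
  (carrier : Type u)
  [action : MulAction G carrier]
  [finite : Finite carrier]

attribute [instance] FinGSet.action FinGSet.finite

/-- Isomorphism of finite `G`-sets: an equivariant bijection. -/
instance FinGSet.isoSetoid (G : Type u) [Group G] : Setoid (FinGSet G) where
  r X Y := ∃ e : X.carrier ≃ Y.carrier, ∀ (g : G) (x : X.carrier), e (g • x) = g • e x
  iseqv :=
    { refl := fun X => ⟨Equiv.refl _, fun _ _ => rfl⟩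
      symm := fun {X Y} ⟨e, he⟩ => ⟨e.symm, fun g y => by
        rw [Equiv.symm_apply_eq, he, Equiv.apply_symm_apply]⟩
      trans := fun {X Y Z} ⟨e, he⟩ ⟨f, hf⟩ => ⟨e.trans f, fun g x => by
        simp [he, hf]⟩ }

/-- Isomorphism classes of finite `G`-sets. -/
def GSetClass (G : Type u) [Group G] : Type (u + 1) := Quotient (FinGSet.isoSetoid G)

namespace GSetClass

variable {G : Type u} [Group G]

/-- The isomorphism class of a finite `G`-set. -/
def mk (X : Type u) [MulAction G X] [Finite X] : GSetClass G :=
  Quotient.mk (FinGSet.isoSetoid G) ⟨X⟩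

theorem mk_eq {X Y : Type u} [MulAction G X] [Finite X] [MulAction G Y] [Finite Y]
    (e : X ≃ Y) (he : ∀ (g : G) (x : X), e (g • x) = g • e x) :
    (mk X : GSetClass G) = mk Y :=
  Quotient.sound ⟨e, he⟩

theorem ind {p : GSetClass G → Prop}
    (h : ∀ (X : Type u) [MulAction G X] [Finite X], p (mk X)) (a : GSetClass G) : p a :=
  Quotient.inductionOn a fun X => h X.carrier

/-- Addition is disjoint union. -/
instance : Add (GSetClass G) :=
  ⟨Quotient.map₂ (fun X Y => ⟨X.carrier ⊕ Y.carrier⟩) (by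
    rintro X X' ⟨e, he⟩ Y Y' ⟨f, hf⟩
    refine ⟨Equiv.sumCongr e f, ?_⟩
    rintro g (x | y)
    · exact congrArg Sum.inl (he g x)
    · exact congrArg Sum.inr (hf g y))⟩

/-- Multiplication is Cartesian product, with the diagonal action. -/
instance : Mul (GSetClass G) :=
  ⟨Quotient.map₂ (fun X Y => ⟨X.carrier × Y.carrier⟩) (by
    rintro X X' ⟨e, he⟩ Y Y' ⟨f, hf⟩
    refine ⟨Equiv.prodCongr e f, ?_⟩
    rintro g ⟨x, y⟩
    exact Prod.ext (he g x) (hf g y))⟩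

/-- The empty `G`-set. -/
instance : Zero (GSetClass G) :=
  ⟨Quotient.mk (FinGSet.isoSetoid G)
    (@FinGSet.mk G _ PEmpty
      { smul := fun _ x => x, one_smul := fun _ => rfl, mul_smul := fun _ _ _ => rfl } _)⟩

/-- The one-point `G`-set. -/
instance : One (GSetClass G) :=
  ⟨Quotient.mk (FinGSet.isoSetoid G)
    (@FinGSet.mk G _ PUnit
      { smul := fun _ x => x, one_smul := fun _ => rfl, mul_smul := fun _ _ _ => rfl } _)⟩

theorem mk_add (X Y : Type u) [MulAction G X] [Finite X] [MulAction G Y] [Finite Y] :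
    (mk X + mk Y : GSetClass G) = mk (X ⊕ Y) := rfl

theorem mk_mul (X Y : Type u) [MulAction G X] [Finite X] [MulAction G Y] [Finite Y] :
    (mk X * mk Y : GSetClass G) = mk (X × Y) := rfl

theorem mk_of_isEmpty (X : Type u) [MulAction G X] [Finite X] [IsEmpty X] :
    (mk X : GSetClass G) = 0 :=
  Quotient.sound ⟨Equiv.equivOfIsEmpty X PEmpty, fun _ x => isEmptyElim x⟩

theorem mk_of_unique (X : Type u) [MulAction G X] [Finite X] [Unique X] :
    (mk X : GSetClass G) = 1 :=
  Quotient.sound ⟨Equiv.ofUnique X PUnit, fun _ _ => rfl⟩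

theorem mul_comm' (a b : GSetClass G) : a * b = b * a := by
  induction a using ind with | h X =>
  induction b using ind with | h Y =>
  exact mk_eq (Equiv.prodComm X Y) fun _ _ => rfl

theorem zero_mul' (a : GSetClass G) : 0 * a = 0 := by
  induction a using ind with | h X =>
  refine Quotient.sound ⟨Equiv.pemptyProd X, ?_⟩
  rintro g ⟨x, _⟩
  exact x.elim

theorem one_mul' (a : GSetClass G) : 1 * a = a := by
  induction a using ind with | h X =>
  exact Quotient.sound ⟨Equiv.punitProd X, fun _ _ => rfl⟩

theorem zero_add' (a : GSetClass G) : 0 + a = a := by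
  induction a using ind with | h X =>
  refine Quotient.sound ⟨Equiv.emptySum PEmpty X, ?_⟩
  rintro g (x | x)
  · exact x.elim
  · rfl

theorem add_comm' (a b : GSetClass G) : a + b = b + a := by
  induction a using ind with | h X =>
  induction b using ind with | h Y =>
  refine mk_eq (Equiv.sumComm X Y) ?_
  rintro g (x | x) <;> rfl

theorem add_mul' (a b c : GSetClass G) : (a + b) * c = a * c + b * c := by
  induction a using ind with | h X =>
  induction b using ind with | h Y =>
  induction c using ind with | h Z =>
  refine mk_eq (Equiv.sumProdDistrib X Y Z) ?_
  rintro g ⟨x | x, z⟩ <;> rfl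

instance : CommSemiring (GSetClass G) where
  add_assoc a b c := by
    induction a using ind with | h X =>
    induction b using ind with | h Y =>
    induction c using ind with | h Z =>
    refine mk_eq (Equiv.sumAssoc X Y Z) ?_
    rintro g ((x | x) | x) <;> rfl
  zero_add := zero_add'
  add_zero a := by rw [add_comm', zero_add']
  add_comm := add_comm'
  mul_assoc a b c := by
    induction a using ind with | h X =>
    induction b using ind with | h Y =>
    induction c using ind with | h Z =>
    exact mk_eq (Equiv.prodAssoc X Y Z) fun _ _ => rfl
  one_mul := one_mul'
  mul_one a := by rw [mul_comm', one_mul']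
  mul_comm := mul_comm'
  zero_mul := zero_mul'
  mul_zero a := by rw [mul_comm', zero_mul']
  right_distrib := add_mul'
  left_distrib a b c := by
    rw [mul_comm', add_mul', mul_comm' b, mul_comm' c]
  nsmul := nsmulRec

/-- The number of `K`-fixed points, as a semiring homomorphism on classes of finite `G`-sets. -/
def fixedCard (K : Subgroup G) : GSetClass G →+* ℤ where
  toFun := Quotient.lift (fun X => (Nat.card (MulAction.fixedPoints K X.carrier) : ℤ)) (by
    rintro X Y ⟨e, he⟩
    refine congrArg Nat.cast (Nat.card_congr (e.subtypeEquiv fun x => ?_))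
    refine forall_congr' fun k => ?_
    have h : k • e x = e (k • x) := (he k x).symm
    rw [h, e.apply_eq_iff_eq])
  map_zero' := by
    refine (congrArg Nat.cast ?_).trans Nat.cast_zero
    exact @Nat.card_of_isEmpty _ ⟨fun x => x.1.elim⟩
  map_one' := by
    refine (congrArg Nat.cast ?_).trans Nat.cast_one
    exact @Nat.card_unique _ ⟨⟨PUnit.unit, fun _ => rfl⟩⟩ ⟨fun _ _ => Subtype.ext rfl⟩
  map_add' a b := by
    induction a using ind with | h X =>
    induction b using ind with | h Y =>
    refine (congrArg Nat.cast ?_).trans (Nat.cast_add _ _)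
    rw [← Nat.card_sum]
    refine Nat.card_congr (Equiv.subtypeSum.trans (Equiv.sumCongr ?_ ?_))
    · exact Equiv.subtypeEquivRight fun x => forall_congr' fun k => Sum.inl_injective.eq_iff
    · exact Equiv.subtypeEquivRight fun x => forall_congr' fun k => Sum.inr_injective.eq_iff
  map_mul' a b := by
    induction a using ind with | h X =>
    induction b using ind with | h Y =>
    refine (congrArg Nat.cast ?_).trans (Nat.cast_mul _ _)
    rw [← Nat.card_prod]
    refine Nat.card_congr (Equiv.trans (Equiv.subtypeEquivRight fun x => ?_)
      (Equiv.subtypeProdEquivProd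
        (p := (· ∈ MulAction.fixedPoints K X)) (q := (· ∈ MulAction.fixedPoints K Y))))
    simp only [MulAction.mem_fixedPoints, ← forall_and]
    exact forall_congr' fun k => Prod.ext_iff

end GSetClass

/-- The Burnside ring of `G`: the Grothendieck ring of the semiring of isomorphism classes of
finite `G`-sets under disjoint union and Cartesian product. -/
abbrev BurnsideRing (G : Type u) [Group G] : Type (u + 1) := GrothendieckRing (GSetClass G)

namespace BurnsideRing

/-- The element `[X]` of the Burnside ring. -/
def cls (G : Type u) [Group G] (X : Type u) [MulAction G X] [Finite X] : BurnsideRing G :=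
  GrothendieckRing.of (GSetClass.mk X)

/-- The mark homomorphism `φ_K : B(G) → ℤ`, with `φ_K([X])` the number of `K`-fixed points of `X`. -/
def mark {G : Type u} [Group G] (K : Subgroup G) : BurnsideRing G →+* ℤ :=
  GrothendieckRing.lift (GSetClass.fixedCard K)

variable {G : Type u} [Group G]

theorem mark_cls (K : Subgroup G) (X : Type u) [MulAction G X] [Finite X] :
    mark K (cls G X) = Nat.card (MulAction.fixedPoints K X) :=
  GrothendieckRing.liftAdd_ofAdd (GSetClass.fixedCard K).toAddMonoidHom (GSetClass.mk X)

variable [Finite G]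

/-- The element `[G/H]` of the Burnside ring. -/
def coset (H : Subgroup G) : BurnsideRing G := cls G (G ⧸ H)

end BurnsideRing

/-! ### Partial Burnside rings -/

/-- A collection of `G`: a family of subgroups containing `G` and closed under intersection and
conjugation. -/
structure IsCollection {G : Type u} [Group G] (D : Set (Subgroup G)) : Prop where
  top_mem : ⊤ ∈ D
  inf_mem : ∀ H ∈ D, ∀ K ∈ D, H ⊓ K ∈ D
  conj_mem : ∀ H ∈ D, ∀ g : G, H.map (MulAut.conj g).toMonoidHom ∈ D

namespace BurnsideRing

variable {G : Type u} [Group G] [Finite G]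

/-- The `ℤ`-span of the `[G/H]` with `H ∈ D`. -/
def cosetSpan (D : Set (Subgroup G)) : AddSubgroup (BurnsideRing G) :=
  AddSubgroup.closure {x | ∃ H ∈ D, x = coset H}

/-- If all point stabilizers of `X` lie in `D`, then `[X]` is in the span of the `[G/H]`,
`H ∈ D`. -/
theorem cls_mem_cosetSpan (D : Set (Subgroup G)) (n : ℕ) :
    ∀ (X : Type u) [MulAction G X] [Finite X], Nat.card X = n →
      (∀ x : X, MulAction.stabilizer G x ∈ D) → cls G X ∈ cosetSpan D := by
  induction n using Nat.strong_induction_on with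
  | _ n ih =>
  intro X _ _ hn hD
  by_cases hX : IsEmpty X
  · rw [cls, GSetClass.mk_of_isEmpty, map_zero]
    exact zero_mem _
  rw [not_isEmpty_iff] at hX
  obtain ⟨x⟩ := hX
  classical
  let Y : SubMulAction G X :=
    { carrier := (MulAction.orbit G x)ᶜ
      smul_mem' := fun g y hy h => hy (by
        have := MulAction.mem_orbit_of_mem_orbit g⁻¹ h
        rwa [inv_smul_smul] at this) }
  have hsplit : cls G X = coset (MulAction.stabilizer G x) + cls G Y := by
    have h1 : (GSetClass.mk (G ⧸ MulAction.stabilizer G x) : GSetClass G) =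
        GSetClass.mk (MulAction.orbit G x) := by
      refine GSetClass.mk_eq (MulAction.orbitEquivQuotientStabilizer G x).symm ?_
      intro g q
      induction q using QuotientGroup.induction_on with | H a =>
      apply Subtype.ext
      change ((MulAction.orbitEquivQuotientStabilizer G x).symm ((g * a : G) : G ⧸ _) : X) =
        g • ((MulAction.orbitEquivQuotientStabilizer G x).symm (a : G ⧸ _) : X)
      rw [MulAction.orbitEquivQuotientStabilizer_symm_apply,
        MulAction.orbitEquivQuotientStabilizer_symm_apply, mul_smul]
    have h2 : (GSetClass.mk (MulAction.orbit G x ⊕ Y) : GSetClass G) = GSetClass.mk X := by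
      refine GSetClass.mk_eq (Equiv.Set.sumCompl (MulAction.orbit G x)) ?_
      rintro g (y | y) <;> rfl
    rw [cls, coset, cls, cls, ← map_add, h1, GSetClass.mk_add, h2]
  rw [hsplit]
  refine add_mem (AddSubgroup.subset_closure ⟨_, hD x, rfl⟩) (ih (Nat.card Y) ?_ Y rfl ?_)
  · rw [← hn]
    exact Finite.card_subtype_lt (p := (· ∈ Y)) (x := x)
      fun h => h (MulAction.mem_orbit_self x)
  · intro y
    rw [SubMulAction.stabilizer_of_subMul]
    exact hD y

theorem stabilizer_quotient_mem {D : Set (Subgroup G)} (hD : IsCollection D)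
    {H : Subgroup G} (hH : H ∈ D) (q : G ⧸ H) : MulAction.stabilizer G q ∈ D := by
  induction q using QuotientGroup.induction_on with | H a =>
  have h : MulAction.stabilizer G (a : G ⧸ H) = H.map (MulAut.conj a).toMonoidHom := by
    have e : (a : G ⧸ H) = a • ((1 : G) : G ⧸ H) :=
      congrArg (QuotientGroup.mk (s := H)) (mul_one a).symm
    rw [e, MulAction.stabilizer_smul_eq_stabilizer_map_conj, MulAction.stabilizer_quotient]
  rw [h]
  exact hD.conj_mem H hH a

/-- The partial Burnside ring `B(G, D)` relative to a collection `D`: the subring of `B(G)` which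
as an additive group is spanned by the `[G/H]` with `H ∈ D`. -/
def partialRing (D : Set (Subgroup G)) (hD : IsCollection D) : Subring (BurnsideRing G) :=
  { cosetSpan D with
    one_mem' := by
      refine AddSubgroup.subset_closure ⟨⊤, hD.top_mem, ?_⟩
      have : Subsingleton (G ⧸ (⊤ : Subgroup G)) := QuotientGroup.subsingleton_quotient_top
      have : Unique (G ⧸ (⊤ : Subgroup G)) :=
        ⟨⟨((1 : G) : G ⧸ _)⟩, fun _ => Subsingleton.elim _ _⟩
      rw [coset, cls, GSetClass.mk_of_unique, map_one]
    mul_mem' := by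
      intro x y hx hy
      change x * y ∈ cosetSpan D
      change x ∈ cosetSpan D at hx
      change y ∈ cosetSpan D at hy
      induction hx using AddSubgroup.closure_induction with
      | zero => rw [zero_mul]; exact zero_mem _
      | add a b _ _ ha hb => rw [add_mul]; exact add_mem ha hb
      | neg a _ ha => rw [neg_mul]; exact neg_mem ha
      | mem a ha =>
        obtain ⟨H, hH, rfl⟩ := ha
        induction hy using AddSubgroup.closure_induction with
        | zero => rw [mul_zero]; exact zero_mem _
        | add a b _ _ ha hb => rw [mul_add]; exact add_mem ha hb
        | neg a _ ha => rw [mul_neg]; exact neg_mem ha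
        | mem b hb =>
          obtain ⟨K, hK, rfl⟩ := hb
          have h : coset H * coset K = cls G ((G ⧸ H) × (G ⧸ K)) := by
            rw [coset, coset, cls, cls, cls, ← map_mul, GSetClass.mk_mul]
          rw [h]
          refine cls_mem_cosetSpan D _ _ rfl ?_
          rintro ⟨p, q⟩
          have hs : MulAction.stabilizer G (p, q) =
              MulAction.stabilizer G p ⊓ MulAction.stabilizer G q := by
            ext g
            exact Prod.ext_iff
          rw [hs]
          exact hD.inf_mem _ (stabilizer_quotient_mem hD hH p) _
            (stabilizer_quotient_mem hD hK q) }

end BurnsideRing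

/-- The set of all normal subgroups of `G`. -/
def Nsub (G : Type u) [Group G] : Set (Subgroup G) := {N | N.Normal}

theorem isCollection_Nsub (G : Type u) [Group G] : IsCollection (Nsub G) where
  top_mem := inferInstanceAs (⊤ : Subgroup G).Normal
  inf_mem H hH K hK := by
    have : H.Normal := hH
    have : K.Normal := hK
    exact inferInstanceAs (H ⊓ K).Normal
  conj_mem H hH g := hH.map _ (MulAut.conj g).surjective

/-! ### Seminilpotent groups and the Frobenius–Wielandt homomorphism -/

/-- A finite group `G` is `p ^ a`-seminilpotent if, for every subgroup `K` whose index is divisible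
by `p ^ a`, there is a normal subgroup of index `p ^ a` containing `K`, and the number of such
normal subgroups is congruent to `1` modulo `p`. -/
def IsSeminilpotent (p a : ℕ) (G : Type u) [Group G] : Prop :=
  ∀ K : Subgroup G, p ^ a ∣ K.index →
    (∃ N : Subgroup G, N.Normal ∧ K ≤ N ∧ N.index = p ^ a) ∧
      Nat.card {N : Subgroup G // N.Normal ∧ K ≤ N ∧ N.index = p ^ a} ≡ 1 [MOD p]

/-- `α : B(C) → B(G)`, with `C` cyclic of order `|G|`, is the Frobenius–Wielandt homomorphism:
`φ_K(α(x)) = φ_L(x)` for every subgroup `K` of `G`, where `L` is the subgroup of `C` of order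
`|K|`. -/
def IsFrobeniusWielandt {G : Type u} [Group G] {C : Type v} [Group C]
    (α : BurnsideRing C →+* BurnsideRing G) : Prop :=
  ∀ (K : Subgroup G) (L : Subgroup C), Nat.card L = Nat.card K →
    ∀ x : BurnsideRing C, BurnsideRing.mark K (α x) = BurnsideRing.mark L x

/-- The element `u_N = 1 - [G/N]` of the Burnside ring. -/
def uElem {G : Type u} [Group G] [Finite G] (N : Subgroup G) : BurnsideRing G :=
  1 - BurnsideRing.coset N

end

/-!
An element of a Burnside ring is determined by its marks, so `α` is unique. For existence, the
number of `K`-stable `d`-element subsets of `G` depends only on `|G|`, `|K|` and `d`, so `α` must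
send the class of the `C`-set of `d`-element subsets of `C` to that of its analogue for `G`; since
`C` is cyclic, a triangularity argument shows that these classes span `B(C)`.

Let `v_G` be the product of the `u_N` over the subgroups `N` of index `2`. If `G` is
`2`-seminilpotent, then the mark of `v_G` at `K` is `-1` or `1` according to whether `|G : K|` is
even or odd. Cyclic groups are `2`-seminilpotent, so `α v_C = v_G`. Finally, a unit has marks `±1`,
while the mark of an element of `B(G, Nsub(G))` at a maximal `N` of its support is divisible by
`|G : N|`; applied to a difference of two units, this shows that units of `B(G, Nsub(G))` are
determined by their marks at `G` and at the subgroups of index `2`. Hence `B(C)ˣ = ⟨-1, v_C⟩`.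
-/

noncomputable section

/-! ### Subgroups of finite cyclic groups -/

section Cyclic

variable {C : Type u} [Group C] [Finite C] [IsCyclic C]

open scoped IsMulCommutative in
theorem mem_iff_pow_card_eq_one_of_isCyclic {H : Subgroup C} {c : C} :
    c ∈ H ↔ c ^ Nat.card H = 1 := by
  have hle : H ≤ (powMonoidHom (Nat.card H) : C →* C).ker := fun c hc =>
    MonoidHom.mem_ker.2 (congrArg H.subtype (pow_card_eq_one' (x := (⟨c, hc⟩ : H))))
  have hker : H = (powMonoidHom (Nat.card H) : C →* C).ker :=
    Subgroup.eq_of_le_of_card_ge hle <| by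
      rw [IsCyclic.card_powMonoidHom_ker, Nat.gcd_eq_right H.card_subgroup_dvd_card]
  conv_lhs => rw [hker]
  exact MonoidHom.mem_ker

theorem le_iff_card_dvd_card_of_isCyclic {H K : Subgroup C} :
    H ≤ K ↔ Nat.card H ∣ Nat.card K := by
  refine ⟨Subgroup.card_dvd_of_le, fun h c hc => ?_⟩
  rw [mem_iff_pow_card_eq_one_of_isCyclic] at hc ⊢
  obtain ⟨m, hm⟩ := h
  rw [hm, pow_mul, hc, one_pow]

theorem eq_of_index_eq_of_isCyclic {H K : Subgroup C} (h : H.index = K.index) : H = K := by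
  have hcard : Nat.card H = Nat.card K :=
    Nat.eq_of_mul_eq_mul_right (Nat.pos_of_ne_zero H.index_ne_zero_of_finite)
      (by rw [H.card_mul_index, h, K.card_mul_index])
  exact le_antisymm (le_iff_card_dvd_card_of_isCyclic.2 hcard.dvd)
    (le_iff_card_dvd_card_of_isCyclic.2 hcard.symm.dvd)

open scoped IsMulCommutative in
theorem exists_subgroup_card_eq_of_isCyclic {d : ℕ} (hd : d ∣ Nat.card C) :
    ∃ H : Subgroup C, Nat.card H = d :=
  ⟨(powMonoidHom d : C →* C).ker, by rw [IsCyclic.card_powMonoidHom_ker, Nat.gcd_eq_right hd]⟩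

theorem exists_subgroup_card_eq_card_of_isCyclic {G : Type v} [Group G]
    (hC : Nat.card C = Nat.card G) (K : Subgroup G) :
    ∃ L : Subgroup C, Nat.card L = Nat.card K :=
  exists_subgroup_card_eq_of_isCyclic (hC ▸ K.card_subgroup_dvd_card)

theorem isSeminilpotent_of_isCyclic (p a : ℕ) : IsSeminilpotent p a C := by
  intro K hK
  obtain ⟨N, hN⟩ := exists_subgroup_card_eq_of_isCyclic (C := C)
    (Nat.div_dvd_of_dvd (hK.trans K.index_dvd_card))
  have hindex : N.index = p ^ a :=
    Nat.eq_of_mul_eq_mul_left (Nat.card_pos (α := N))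
      (by rw [N.card_mul_index, hN, Nat.div_mul_cancel (hK.trans K.index_dvd_card)])
  have hKN : K ≤ N := by
    refine le_iff_card_dvd_card_of_isCyclic.2 (Nat.dvd_of_mul_dvd_mul_right
      (Nat.pos_of_ne_zero N.index_ne_zero_of_finite) ?_)
    rw [N.card_mul_index, ← K.card_mul_index, hindex]
    exact mul_dvd_mul_left _ hK
  have hunique : ∀ M : Subgroup C, M.Normal ∧ K ≤ M ∧ M.index = p ^ a ↔ M = N := fun M =>
    ⟨fun hM => eq_of_index_eq_of_isCyclic (hM.2.2.trans hindex.symm),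
      fun hM => hM ▸ ⟨inferInstance, hKN, hindex⟩⟩
  refine ⟨⟨N, (hunique N).2 rfl⟩, ?_⟩
  simp only [hunique, Nat.card_unique]
  rfl

end Cyclic

namespace BurnsideRing

/-! ### Marks -/

section Marks

variable {G : Type u} [Group G]

theorem cls_sum (X Y : Type u) [MulAction G X] [Finite X] [MulAction G Y] [Finite Y] :
    cls G (X ⊕ Y) = cls G X + cls G Y := by
  rw [cls, cls, cls, ← map_add, GSetClass.mk_add]

theorem exists_eq_cls_sub_cls (x : BurnsideRing G) :
    ∃ X Y : FinGSet G, x = cls G X.carrier - cls G Y.carrier := by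
  obtain ⟨a, b, rfl⟩ := GrothendieckRing.exists_sub x
  induction a using GSetClass.ind with | h X =>
  induction b using GSetClass.ind with | h Y =>
  exact ⟨⟨X⟩, ⟨Y⟩, rfl⟩

theorem mark_cls_eq_card_le_stabilizer (K : Subgroup G) (X : Type u) [MulAction G X] [Finite X] :
    mark K (cls G X) = Nat.card {x : X // K ≤ MulAction.stabilizer G x} := by
  rw [mark_cls]
  exact congrArg Nat.cast (Nat.card_congr (Equiv.subtypeEquivRight fun x =>
    ⟨fun h k hk => h ⟨k, hk⟩, fun h k => h k.2⟩))

theorem mark_cls_ne_zero_iff (K : Subgroup G) (X : Type u) [MulAction G X] [Finite X] :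
    mark K (cls G X) ≠ 0 ↔ ∃ x : X, K ≤ MulAction.stabilizer G x := by
  rw [mark_cls_eq_card_le_stabilizer, Nat.cast_ne_zero, ← Nat.pos_iff_ne_zero,
    Finite.card_pos_iff, nonempty_subtype]

theorem stabilizer_quotient_of_normal {N : Subgroup G} [N.Normal] (q : G ⧸ N) :
    MulAction.stabilizer G q = N := by
  induction q using QuotientGroup.induction_on with | H a =>
  ext g
  rw [MulAction.mem_stabilizer_iff, MulAction.Quotient.smul_coe, smul_eq_mul, eq_comm,
    QuotientGroup.eq, ← mul_assoc, Subgroup.Normal.mem_comm_iff ‹N.Normal›, mul_inv_cancel_left]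

variable [Finite G]

theorem cls_orbit {X : Type u} [MulAction G X] [Finite X] (x : X) :
    cls G (MulAction.orbit G x) = coset (MulAction.stabilizer G x) := by
  refine congrArg GrothendieckRing.of
    (GSetClass.mk_eq (MulAction.orbitEquivQuotientStabilizer G x).symm fun g q => ?_).symm
  induction q using QuotientGroup.induction_on with | H a =>
  exact Subtype.ext (mul_smul g a x)

theorem exists_cls_eq_coset_stabilizer_add {X : Type u} [MulAction G X] [Finite X] (x : X) :
    ∃ Y : SubMulAction G X, x ∉ Y ∧ cls G X = coset (MulAction.stabilizer G x) + cls G Y := by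
  classical
  let Y : SubMulAction G X :=
    { carrier := (MulAction.orbit G x)ᶜ
      smul_mem' := fun g y hy h => hy (by rwa [← MulAction.orbit_eq_iff, MulAction.orbit_smul,
        MulAction.orbit_eq_iff] at h) }
  refine ⟨Y, fun h => h (MulAction.mem_orbit_self x), ?_⟩
  have hmk : (GSetClass.mk (MulAction.orbit G x ⊕ Y) : GSetClass G) = GSetClass.mk X :=
    GSetClass.mk_eq (Equiv.Set.sumCompl (MulAction.orbit G x)) (by rintro g (y | y) <;> rfl)
  rw [← cls_orbit, ← cls_sum, cls, cls, hmk]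

theorem exists_stabilizer_eq_of_mark_eq {X Y : Type u} [MulAction G X] [Finite X] [Nonempty X]
    [MulAction G Y] [Finite Y] (h : ∀ K : Subgroup G, mark K (cls G X) = mark K (cls G Y)) :
    ∃ (x : X) (y : Y), MulAction.stabilizer G x = MulAction.stabilizer G y := by
  obtain ⟨x, hx⟩ := Finite.exists_max fun x : X => Nat.card (MulAction.stabilizer G x)
  obtain ⟨y, hxy⟩ := (mark_cls_ne_zero_iff (MulAction.stabilizer G x) Y).1
    (h _ ▸ (mark_cls_ne_zero_iff _ X).2 ⟨x, le_rfl⟩)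
  obtain ⟨z, hyz⟩ := (mark_cls_ne_zero_iff (MulAction.stabilizer G y) X).1
    (h _ ▸ (mark_cls_ne_zero_iff _ Y).2 ⟨y, le_rfl⟩)
  exact ⟨x, y, Subgroup.eq_of_le_of_card_ge hxy ((Subgroup.card_le_of_le hyz).trans (hx z))⟩

theorem cls_eq_of_mark_eq {X Y : Type u} [MulAction G X] [Finite X] [MulAction G Y] [Finite Y]
    (h : ∀ K : Subgroup G, mark K (cls G X) = mark K (cls G Y)) : cls G X = cls G Y := by
  induction hn : Nat.card X using Nat.strong_induction_on generalizing X Y with | _ n ih =>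
  rcases isEmpty_or_nonempty X with hX | hX
  · have hY : IsEmpty Y := by
      by_contra! ⟨y⟩
      obtain ⟨x, -⟩ :=
        (mark_cls_ne_zero_iff ⊥ X).1 (h ⊥ ▸ (mark_cls_ne_zero_iff ⊥ Y).2 ⟨y, bot_le⟩)
      exact hX.elim x
    rw [cls, cls, GSetClass.mk_of_isEmpty, GSetClass.mk_of_isEmpty]
  obtain ⟨x, y, hxy⟩ := exists_stabilizer_eq_of_mark_eq h
  obtain ⟨X', hxX', hX'⟩ := exists_cls_eq_coset_stabilizer_add (G := G) x
  obtain ⟨Y', -, hY'⟩ := exists_cls_eq_coset_stabilizer_add (G := G) y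
  have hcard : Nat.card X' < n := hn ▸ Finite.card_subtype_lt hxX'
  have hmark : ∀ K : Subgroup G, mark K (cls G X') = mark K (cls G Y') := fun K => by
    simpa only [hX', hY', hxy, map_add, add_right_inj] using h K
  rw [hX', hY', hxy, ih _ hcard hmark rfl]

theorem ext_mark {x y : BurnsideRing G} (h : ∀ K : Subgroup G, mark K x = mark K y) : x = y := by
  obtain ⟨X, Y, rfl⟩ := exists_eq_cls_sub_cls x
  obtain ⟨Z, W, rfl⟩ := exists_eq_cls_sub_cls y
  rw [sub_eq_sub_iff_add_eq_add, ← cls_sum, ← cls_sum]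
  refine cls_eq_of_mark_eq fun K => ?_
  rw [cls_sum, cls_sum, map_add, map_add, ← sub_eq_sub_iff_add_eq_add, ← map_sub, ← map_sub, h]

open scoped Classical in
theorem mark_coset_of_normal (K N : Subgroup G) [N.Normal] :
    mark K (coset N) = if K ≤ N then (N.index : ℤ) else 0 := by
  simp only [coset, mark_cls_eq_card_le_stabilizer, stabilizer_quotient_of_normal]
  split_ifs with h
  · rw [Subgroup.index, Nat.card_congr (Equiv.subtypeUnivEquiv fun _ => h)]
  · have : IsEmpty {_q : G ⧸ N // K ≤ N} := ⟨fun q => h q.2⟩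
    rw [Nat.card_of_isEmpty, Nat.cast_zero]

end Marks

/-! ### Supports -/

section Support

variable {G : Type u} [Group G] [Finite G]

theorem mem_cosetSpan_iff {D : Set (Subgroup G)} {x : BurnsideRing G} :
    x ∈ cosetSpan D ↔
      ∃ a ∈ Finsupp.supported ℤ ℤ D, Finsupp.linearCombination ℤ coset a = x := by
  have hspan : (Submodule.span ℤ (coset '' D)).toAddSubgroup = cosetSpan D := by
    rw [Submodule.span_int_eq_addSubgroupClosure, cosetSpan]
    simp only [Set.image, eq_comm]
  rw [← hspan, Submodule.mem_toAddSubgroup, Finsupp.mem_span_image_iff_linearCombination]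

theorem mem_cosetSpan_Nsub [IsMulCommutative G] (x : BurnsideRing G) : x ∈ cosetSpan (Nsub G) := by
  obtain ⟨X, Y, rfl⟩ := exists_eq_cls_sub_cls x
  exact sub_mem
    (cls_mem_cosetSpan _ _ _ rfl fun _ => Subgroup.normal_of_isMulCommutative _)
    (cls_mem_cosetSpan _ _ _ rfl fun _ => Subgroup.normal_of_isMulCommutative _)

theorem mark_linearCombination_coset {a : Subgroup G →₀ ℤ}
    (ha : a ∈ Finsupp.supported ℤ ℤ (Nsub G)) {H : Subgroup G} [H.Normal]
    (hmax : ∀ K ∈ a.support, ¬ H < K) :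
    mark H (Finsupp.linearCombination ℤ coset a) = a H * H.index := by
  classical
  rw [Finsupp.linearCombination_apply, Finsupp.sum, map_sum, Finset.sum_eq_single H]
  · rw [map_zsmul, mark_coset_of_normal, if_pos le_rfl, smul_eq_mul]
  · intro K hK hKH
    have : K.Normal := ha hK
    rw [map_zsmul, mark_coset_of_normal, if_neg fun hle => hmax K hK (lt_of_le_of_ne' hle hKH),
      smul_zero]
  · intro hH
    rw [Finsupp.notMem_support_iff.1 hH, zero_smul, map_zero]

end Support

/-! ### Subsets of a given size -/

section Subsets

variable {G : Type u} [Group G] [Finite G]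

open scoped Pointwise

/-- The union of the right cosets `(aK)⁻¹ = K a⁻¹`, for `aK ∈ T`. These unions are the subsets of
`G` that are stable under left translation by `K`. -/
def rightCosetUnion (K : Subgroup G) (T : Finset (G ⧸ K)) : Finset G :=
  (Set.toFinite {g : G | ((g⁻¹ : G) : G ⧸ K) ∈ T}).toFinset

theorem mem_rightCosetUnion {K : Subgroup G} {T : Finset (G ⧸ K)} {g : G} :
    g ∈ rightCosetUnion K T ↔ ((g⁻¹ : G) : G ⧸ K) ∈ T :=
  Set.Finite.mem_toFinset _

theorem card_rightCosetUnion (K : Subgroup G) (T : Finset (G ⧸ K)) :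
    (rightCosetUnion K T).card = Nat.card K * T.card := by
  have hcoe : (rightCosetUnion K T : Set G) = (QuotientGroup.mk ⁻¹' (T : Set (G ⧸ K)))⁻¹ := by
    ext g
    exact mem_rightCosetUnion
  rw [← Set.ncard_coe_finset, ← Set.ncard_coe_finset T, hcoe, Set.ncard_inv,
    ← Nat.card_coe_set_eq, ← Nat.card_coe_set_eq, ← Nat.card_prod,
    Nat.card_congr (QuotientGroup.preimageMkEquivSubgroupProdSet K T)]

theorem rightCosetUnion_injective (K : Subgroup G) : Function.Injective (rightCosetUnion K) := by
  intro S T h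
  ext q
  induction q using QuotientGroup.induction_on with | H a =>
  simpa only [mem_rightCosetUnion, inv_inv] using Finset.ext_iff.1 h a⁻¹

open scoped Classical in
theorem forall_smul_eq_iff_mem_range_rightCosetUnion {K : Subgroup G} {s : Finset G} :
    (∀ k : K, k • s = s) ↔ s ∈ Set.range (rightCosetUnion K) := by
  constructor
  · intro hs
    refine ⟨s.image fun g => ((g⁻¹ : G) : G ⧸ K), ?_⟩
    ext g
    simp only [mem_rightCosetUnion, Finset.mem_image]
    refine ⟨?_, fun hg => ⟨g, hg, rfl⟩⟩
    rintro ⟨h, hh, hgh⟩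
    have hk : g * h⁻¹ ∈ K := by simpa only [inv_inv] using QuotientGroup.eq.1 hgh.symm
    have hmem : (⟨g * h⁻¹, hk⟩ : K) • h ∈ s :=
      (hs ⟨g * h⁻¹, hk⟩).subset (Finset.smul_mem_smul_finset hh)
    rwa [Subgroup.mk_smul, smul_eq_mul, inv_mul_cancel_right] at hmem
  · rintro ⟨T, rfl⟩ k
    ext g
    rw [← Finset.inv_smul_mem_iff, mem_rightCosetUnion, mem_rightCosetUnion, Subgroup.smul_def,
      smul_eq_mul, mul_inv_rev, Subgroup.coe_inv, inv_inv, QuotientGroup.mk_mul_of_mem _ k.2]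

open scoped Classical in
/-- The class of the `G`-set of `d`-element subsets of `G`, on which `G` acts by left
translation. -/
def subsetsCls (G : Type u) [Group G] [Finite G] (d : ℕ) : BurnsideRing G :=
  cls G (Set.powersetCard G d)

open scoped Classical in
theorem card_fixedPoints_powersetCard (K : Subgroup G) (d : ℕ) :
    Nat.card (MulAction.fixedPoints K (Set.powersetCard G d)) =
      Nat.card {T : Finset (G ⧸ K) // Nat.card K * T.card = d} := by
  have hfixed : ∀ s : Set.powersetCard G d, s ∈ MulAction.fixedPoints K (Set.powersetCard G d) ↔
      (s : Finset G) ∈ Set.range (rightCosetUnion K) := fun s => by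
    rw [← forall_smul_eq_iff_mem_range_rightCosetUnion]
    exact forall_congr' fun k => Subtype.ext_iff
  refine (Nat.card_congr (Equiv.ofBijective (fun T => ⟨⟨rightCosetUnion K T,
    (card_rightCosetUnion K T).trans T.2⟩, (hfixed _).2 ⟨T, rfl⟩⟩) ⟨?_, ?_⟩)).symm
  · intro S T h
    exact Subtype.ext (rightCosetUnion_injective K (congrArg (fun s => s.1.1) h))
  · rintro ⟨⟨s, hs⟩, hsK⟩
    obtain ⟨T, rfl⟩ := (hfixed _).1 hsK
    exact ⟨⟨T, (card_rightCosetUnion K T).symm.trans hs⟩, rfl⟩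

open scoped Classical in
theorem mark_subsetsCls (K : Subgroup G) (d : ℕ) :
    mark K (subsetsCls G d) =
      if Nat.card K ∣ d then (K.index.choose (d / Nat.card K) : ℤ) else 0 := by
  rw [subsetsCls, mark_cls, card_fixedPoints_powersetCard]
  split_ifs with h
  · have hcard : ∀ T : Finset (G ⧸ K), Nat.card K * T.card = d ↔ T.card = d / Nat.card K :=
      fun T => by
        rw [Nat.eq_div_iff_mul_eq_left Nat.card_pos.ne' h, mul_comm, eq_comm]
    rw [Nat.card_congr (Equiv.subtypeEquivRight hcard), Subgroup.index]
    exact congrArg Nat.cast (Set.powersetCard.card _ _)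
  · have : IsEmpty {T : Finset (G ⧸ K) // Nat.card K * T.card = d} :=
      ⟨fun T => h ⟨_, T.2.symm⟩⟩
    rw [Nat.card_of_isEmpty, Nat.cast_zero]

open scoped Classical in
theorem card_stabilizer_dvd_of_powersetCard {d : ℕ} (s : Set.powersetCard G d) :
    Nat.card (MulAction.stabilizer G s) ∣ d := by
  by_contra h
  refine (mark_cls_ne_zero_iff (MulAction.stabilizer G s) _).2 ⟨s, le_rfl⟩ ?_
  exact (mark_subsetsCls _ d).trans (if_neg h)

end Subsets

/-! ### The Frobenius–Wielandt homomorphism -/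

section FrobeniusWielandt

/-- The graph of the Frobenius–Wielandt homomorphism: the pairs in `B(C) × B(G)` whose marks agree
at all subgroups of `C` and `G` of the same order. -/
def frobeniusWielandtGraph (C : Type v) [Group C] (G : Type u) [Group G] :
    Subring (BurnsideRing C × BurnsideRing G) :=
  ⨅ (K : Subgroup G) (L : Subgroup C) (_ : Nat.card L = Nat.card K),
    ((mark K).comp (RingHom.snd _ _)).eqLocus ((mark L).comp (RingHom.fst _ _))

theorem mem_frobeniusWielandtGraph {C : Type v} [Group C] {G : Type u} [Group G]
    {z : BurnsideRing C × BurnsideRing G} :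
    z ∈ frobeniusWielandtGraph C G ↔
      ∀ (K : Subgroup G) (L : Subgroup C), Nat.card L = Nat.card K → mark K z.2 = mark L z.1 := by
  simp only [frobeniusWielandtGraph, Subring.mem_iInf]
  rfl

theorem index_eq_of_card_eq {C : Type v} [Group C] [Finite C] {G : Type u} [Group G]
    (hC : Nat.card C = Nat.card G) {K : Subgroup G} {L : Subgroup C}
    (hL : Nat.card L = Nat.card K) : L.index = K.index :=
  Nat.eq_of_mul_eq_mul_left (Nat.card_pos (α := L))
    (by rw [L.card_mul_index, hC, hL, K.card_mul_index])

theorem subsetsCls_mem_frobeniusWielandtGraph {C : Type v} [Group C] [Finite C] {G : Type u}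
    [Group G] [Finite G] (hC : Nat.card C = Nat.card G) (d : ℕ) :
    (subsetsCls C d, subsetsCls G d) ∈ frobeniusWielandtGraph C G :=
  mem_frobeniusWielandtGraph.2 fun K L hL => by
    rw [mark_subsetsCls, mark_subsetsCls, hL, index_eq_of_card_eq hC hL]

variable {C : Type v} [Group C] [Finite C] [IsCyclic C]

theorem subsetsCls_card_sub_coset_mem_cosetSpan (L : Subgroup C) :
    subsetsCls C (Nat.card L) - coset L ∈ cosetSpan (Set.Iio L) := by
  classical
  have hmem : subsetsCls C (Nat.card L) ∈ cosetSpan (Set.Iic L) :=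
    cls_mem_cosetSpan _ _ _ rfl fun s =>
      le_iff_card_dvd_card_of_isCyclic.2 (card_stabilizer_dvd_of_powersetCard s)
  obtain ⟨a, haL, ha⟩ := mem_cosetSpan_iff.1 hmem
  have hmark : (L.index : ℤ) = a L * L.index := by
    rw [← mark_linearCombination_coset (fun H _ => Subgroup.normal_of_isMulCommutative H)
      fun K hK hLK => (haL hK).not_gt hLK, ha, mark_subsetsCls, if_pos dvd_rfl,
      Nat.div_self Nat.card_pos, Nat.choose_one_right]
  have haL1 : a L = 1 :=
    (mul_eq_right₀ (Nat.cast_ne_zero.2 L.index_ne_zero_of_finite)).1 hmark.symm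
  refine mem_cosetSpan_iff.2 ⟨a.erase L, fun H hH => ?_, ?_⟩
  · rw [Finsupp.support_erase] at hH
    exact lt_of_le_of_ne (haL (Finset.mem_of_mem_erase hH)) (Finset.ne_of_mem_erase hH)
  · rw [← ha, eq_sub_iff_add_eq']
    conv_rhs => rw [← Finsupp.single_add_erase L a]
    rw [map_add, Finsupp.linearCombination_single, haL1, one_smul]

theorem coset_mem_closure_range_subsetsCls (L : Subgroup C) :
    coset L ∈ AddSubgroup.closure (Set.range (subsetsCls C)) := by
  induction L using WellFoundedLT.induction with | _ L ih =>
  have hle : cosetSpan (Set.Iio L) ≤ AddSubgroup.closure (Set.range (subsetsCls C)) :=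
    (AddSubgroup.closure_le _).2 fun _ ⟨H, hH, hx⟩ => hx ▸ ih H hH
  rw [← sub_sub_cancel (subsetsCls C (Nat.card L)) (coset L)]
  exact sub_mem (AddSubgroup.subset_closure ⟨_, rfl⟩)
    (hle (subsetsCls_card_sub_coset_mem_cosetSpan L))

theorem closure_range_subsetsCls :
    AddSubgroup.closure (Set.range (subsetsCls C)) = ⊤ := by
  refine eq_top_iff.2 fun x _ => ?_
  refine (AddSubgroup.closure_le _).2 ?_ (mem_cosetSpan_Nsub x)
  rintro _ ⟨H, -, rfl⟩
  exact coset_mem_closure_range_subsetsCls H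

variable {G : Type u} [Group G] [Finite G]

variable {G : Type u} [Group G] [Finite G]

theorem fst_injective_frobeniusWielandtGraph (hC : Nat.card C = Nat.card G) :
    Function.Injective ((RingHom.fst _ _).comp (frobeniusWielandtGraph C G).subtype) := by
  rintro ⟨⟨x, y⟩, hy⟩ ⟨⟨x', z⟩, hz⟩ (rfl : x = x')
  rw [mem_frobeniusWielandtGraph] at hy hz
  have hyz : y = z := ext_mark fun K => by
    obtain ⟨L, hL⟩ := exists_subgroup_card_eq_card_of_isCyclic hC K
    exact (hy K L hL).trans (hz K L hL).symm
  exact Subtype.ext (congrArg (Prod.mk x) hyz)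

theorem fst_surjective_frobeniusWielandtGraph (hC : Nat.card C = Nat.card G) :
    Function.Surjective ((RingHom.fst _ _).comp (frobeniusWielandtGraph C G).subtype) := by
  set f := (RingHom.fst _ _).comp (frobeniusWielandtGraph C G).subtype
  have hle : AddSubgroup.closure (Set.range (subsetsCls C)) ≤ f.toAddMonoidHom.range :=
    (AddSubgroup.closure_le _).2 <| Set.range_subset_iff.2 fun d =>
      ⟨⟨_, subsetsCls_mem_frobeniusWielandtGraph hC d⟩, rfl⟩
  exact fun x => hle (closure_range_subsetsCls (C := C) ▸ AddSubgroup.mem_top x)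

/-- The Frobenius–Wielandt homomorphism `B(C) → B(G)`, for `C` cyclic of order `|G|`. -/
def frobeniusWielandt (hC : Nat.card C = Nat.card G) : BurnsideRing C →+* BurnsideRing G :=
  ((RingHom.snd _ _).comp (frobeniusWielandtGraph C G).subtype).comp
    (RingEquiv.ofBijective _ ⟨fst_injective_frobeniusWielandtGraph hC,
      fst_surjective_frobeniusWielandtGraph hC⟩).symm.toRingHom

theorem isFrobeniusWielandt_frobeniusWielandt (hC : Nat.card C = Nat.card G) :
    IsFrobeniusWielandt (frobeniusWielandt hC) := by
  intro K L hL x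
  set e := RingEquiv.ofBijective _ ⟨fst_injective_frobeniusWielandtGraph hC,
    fst_surjective_frobeniusWielandtGraph hC⟩
  have hfst : (e.symm x).1.1 = x := e.apply_symm_apply x
  exact (mem_frobeniusWielandtGraph.1 (e.symm x).2 K L hL).trans (by rw [hfst])

theorem eq_of_isFrobeniusWielandt (hC : Nat.card C = Nat.card G)
    {α β : BurnsideRing C →+* BurnsideRing G} (hα : IsFrobeniusWielandt α)
    (hβ : IsFrobeniusWielandt β) : α = β :=
  RingHom.ext fun x => ext_mark fun K => by
    obtain ⟨L, hL⟩ := exists_subgroup_card_eq_card_of_isCyclic hC K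
    exact (hα K L hL x).trans (hβ K L hL x).symm

end FrobeniusWielandt

/-! ### Units -/

section Units

variable {G : Type u} [Group G]

theorem mark_unit_eq_one_or_neg_one (K : Subgroup G) (x : (BurnsideRing G)ˣ) :
    mark K (x : BurnsideRing G) = 1 ∨ mark K (x : BurnsideRing G) = -1 :=
  Int.isUnit_iff.1 (x.isUnit.map (mark K))

variable [Finite G]

theorem units_eq_of_mark_eq {x y : (BurnsideRing G)ˣ}
    (hx : (x : BurnsideRing G) ∈ cosetSpan (Nsub G))
    (hy : (y : BurnsideRing G) ∈ cosetSpan (Nsub G))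
    (htop : mark ⊤ (x : BurnsideRing G) = mark ⊤ (y : BurnsideRing G))
    (htwo : ∀ H : Subgroup G, H.index = 2 →
      mark H (x : BurnsideRing G) = mark H (y : BurnsideRing G)) :
    x = y := by
  obtain ⟨a, haN, ha⟩ := mem_cosetSpan_iff.1 (sub_mem hx hy)
  by_contra hxy
  have hane : a.support.Nonempty := Finsupp.support_nonempty_iff.2 fun ha0 =>
    hxy (Units.ext (sub_eq_zero.1 (by rw [← ha, ha0, map_zero])))
  obtain ⟨H, hmax⟩ := a.support.exists_maximal hane
  have : H.Normal := haN hmax.prop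
  have hmark : mark H (x : BurnsideRing G) - mark H (y : BurnsideRing G) = a H * H.index := by
    rw [← map_sub, ← ha, mark_linearCombination_coset haN fun K hK => hmax.not_gt hK]
  have hne : mark H (x : BurnsideRing G) ≠ mark H (y : BurnsideRing G) := by
    rw [← sub_ne_zero, hmark]
    exact mul_ne_zero (Finsupp.mem_support_iff.1 hmax.prop)
      (Nat.cast_ne_zero.2 H.index_ne_zero_of_finite)
  have hdvd : (H.index : ℤ) ∣ 2 := by
    refine (Dvd.intro_left _ hmark.symm).trans ?_
    rcases mark_unit_eq_one_or_neg_one H x with hx | hx <;>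
      rcases mark_unit_eq_one_or_neg_one H y with hy | hy <;>
      simp_all
  rcases (Nat.dvd_prime Nat.prime_two).1 (Int.natCast_dvd_natCast.1 hdvd) with h | h
  · exact hne (Subgroup.index_eq_one.1 h ▸ htop)
  · exact hne (htwo H h)

open scoped Classical in
theorem mark_uElem {N : Subgroup G} (hN : N.index = 2) (K : Subgroup G) :
    mark K (uElem N) = if K ≤ N then -1 else 1 := by
  have : N.Normal := Subgroup.normal_of_index_eq_two hN
  rw [uElem, map_sub, map_one, mark_coset_of_normal, hN]
  split_ifs <;> rfl

theorem uElem_mul_self {N : Subgroup G} (hN : N.index = 2) : uElem N * uElem N = 1 := by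
  classical
  refine ext_mark fun K => ?_
  rw [map_mul, mark_uElem hN, map_one]
  split_ifs <;> rfl

theorem uElem_mem_partialRing {N : Subgroup G} (hN : N.index = 2) :
    uElem N ∈ partialRing (Nsub G) (isCollection_Nsub G) :=
  sub_mem (one_mem _)
    (AddSubgroup.subset_closure ⟨N, Subgroup.normal_of_index_eq_two hN, rfl⟩)

/-- The subgroups of `G` of index `2`. -/
def indexTwoSubgroups (G : Type u) [Group G] [Finite G] : Finset (Subgroup G) :=
  (Set.toFinite {N : Subgroup G | N.index = 2}).toFinset

theorem mem_indexTwoSubgroups {N : Subgroup G} : N ∈ indexTwoSubgroups G ↔ N.index = 2 :=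
  Set.Finite.mem_toFinset _

/-- The product of the `u_N` over the subgroups `N` of `G` of index `2`, which is its own inverse,
as a unit of `B(G)`. -/
def indexTwoUnit (G : Type u) [Group G] [Finite G] : (BurnsideRing G)ˣ :=
  Units.mkOfMulEqOne (∏ N ∈ indexTwoSubgroups G, uElem N) (∏ N ∈ indexTwoSubgroups G, uElem N) <|
    Finset.prod_mul_distrib.symm.trans
      (Finset.prod_eq_one fun _ hN => uElem_mul_self (mem_indexTwoSubgroups.1 hN))

theorem mark_indexTwoUnit (K : Subgroup G) :
    mark K (indexTwoUnit G : BurnsideRing G) =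
      (-1) ^ Nat.card {N : Subgroup G // N.Normal ∧ K ≤ N ∧ N.index = 2} := by
  classical
  have hcard : ((indexTwoSubgroups G).filter (K ≤ ·)).card =
      Nat.card {N : Subgroup G // N.Normal ∧ K ≤ N ∧ N.index = 2} := by
    refine (Nat.subtype_card _ fun N => ?_).symm
    rw [Finset.mem_filter, mem_indexTwoSubgroups]
    exact ⟨fun h => ⟨Subgroup.normal_of_index_eq_two h.1, h.2, h.1⟩, fun h => ⟨h.2.2, h.2.1⟩⟩
  rw [indexTwoUnit, Units.val_mkOfMulEqOne, map_prod, ← hcard, Finset.prod_congr rfl fun N hN =>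
    mark_uElem (mem_indexTwoSubgroups.1 hN) K, Finset.prod_ite, Finset.prod_const,
    Finset.prod_const_one, mul_one]

theorem closure_neg_one_indexTwoUnit_le_units_partialRing :
    Subgroup.closure {-1, indexTwoUnit G} ≤
      (partialRing (Nsub G) (isCollection_Nsub G)).toSubmonoid.units := by
  have hneg : (-1 : BurnsideRing G) ∈ partialRing (Nsub G) (isCollection_Nsub G) :=
    neg_mem (one_mem _)
  have hprod : ∏ N ∈ indexTwoSubgroups G, uElem N ∈ partialRing (Nsub G) (isCollection_Nsub G) :=
    prod_mem fun N hN => uElem_mem_partialRing (mem_indexTwoSubgroups.1 hN)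
  rw [Subgroup.closure_le, Set.pair_subset_iff]
  exact ⟨⟨hneg, hneg⟩, ⟨hprod, hprod⟩⟩

theorem mark_indexTwoUnit_of_isSeminilpotent (hG : IsSeminilpotent 2 1 G) (K : Subgroup G) :
    mark K (indexTwoUnit G : BurnsideRing G) = if 2 ∣ K.index then -1 else 1 := by
  rw [mark_indexTwoUnit]
  split_ifs with h
  · exact (Nat.odd_iff.2 (hG K h).2).neg_one_pow
  · have : IsEmpty {N : Subgroup G // N.Normal ∧ K ≤ N ∧ N.index = 2} :=
      ⟨fun N => h (N.2.2.2 ▸ Subgroup.index_dvd_of_le N.2.2.1)⟩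
    rw [Nat.card_of_isEmpty, pow_zero]

end Units

section UnitsOfIsCyclic

variable {C : Type v} [Group C] [Finite C] [IsCyclic C]

theorem eq_one_or_eq_indexTwoUnit_of_isCyclic {x : (BurnsideRing C)ˣ}
    (hx : mark ⊤ (x : BurnsideRing C) = 1) : x = 1 ∨ x = indexTwoUnit C := by
  by_cases h : ∃ H : Subgroup C, H.index = 2 ∧ mark H (x : BurnsideRing C) = -1
  · obtain ⟨H, hH, hxH⟩ := h
    refine .inr (units_eq_of_mark_eq (mem_cosetSpan_Nsub _) (mem_cosetSpan_Nsub _) ?_ ?_)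
    · rw [hx, mark_indexTwoUnit_of_isSeminilpotent (isSeminilpotent_of_isCyclic 2 1),
        Subgroup.index_top, if_neg (by decide)]
    · intro K hK
      rw [eq_of_index_eq_of_isCyclic (hK.trans hH.symm), hxH,
        mark_indexTwoUnit_of_isSeminilpotent (isSeminilpotent_of_isCyclic 2 1),
        if_pos hH.symm.dvd]
  · refine .inl (units_eq_of_mark_eq (mem_cosetSpan_Nsub _) (mem_cosetSpan_Nsub _) ?_ ?_)
    · rw [hx, Units.val_one, map_one]
    · intro K hK
      rw [(mark_unit_eq_one_or_neg_one K x).resolve_right fun hxK => h ⟨K, hK, hxK⟩,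
        Units.val_one, map_one]

theorem closure_neg_one_indexTwoUnit_eq_top_of_isCyclic :
    Subgroup.closure {-1, indexTwoUnit C} = ⊤ := by
  have hmem : ∀ x : (BurnsideRing C)ˣ, mark ⊤ (x : BurnsideRing C) = 1 →
      x ∈ Subgroup.closure {-1, indexTwoUnit C} := fun x hx => by
    rcases eq_one_or_eq_indexTwoUnit_of_isCyclic hx with rfl | rfl
    · exact one_mem _
    · exact Subgroup.subset_closure (.inr rfl)
  refine eq_top_iff.2 fun x _ => ?_
  rcases mark_unit_eq_one_or_neg_one ⊤ x with hx | hx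
  · exact hmem x hx
  · rw [← neg_neg x, neg_eq_neg_one_mul (-x)]
    exact mul_mem (Subgroup.subset_closure (.inl rfl))
      (hmem _ (by rw [Units.val_neg, map_neg, hx, neg_neg]))

variable {G : Type u} [Group G] [Finite G]

theorem map_indexTwoUnit {α : BurnsideRing C →+* BurnsideRing G} (hα : IsFrobeniusWielandt α)
    (hC : Nat.card C = Nat.card G) (hG : IsSeminilpotent 2 1 G) :
    Units.map (α : BurnsideRing C →* BurnsideRing G) (indexTwoUnit C) = indexTwoUnit G :=
  Units.ext <| ext_mark fun K => by
    obtain ⟨L, hL⟩ := exists_subgroup_card_eq_card_of_isCyclic hC K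
    rw [mark_indexTwoUnit_of_isSeminilpotent hG, ← index_eq_of_card_eq hC hL,
      ← mark_indexTwoUnit_of_isSeminilpotent (isSeminilpotent_of_isCyclic 2 1)]
    exact hα K L hL _

theorem range_units_map {α : BurnsideRing C →+* BurnsideRing G} (hα : IsFrobeniusWielandt α)
    (hC : Nat.card C = Nat.card G) (hG : IsSeminilpotent 2 1 G) :
    (Units.map (α : BurnsideRing C →* BurnsideRing G)).range =
      Subgroup.closure {-1, indexTwoUnit G} := by
  have hneg : Units.map (α : BurnsideRing C →* BurnsideRing G) (-1) = -1 :=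
    Units.ext (map_neg α 1 |>.trans (congrArg Neg.neg (map_one α)))
  rw [MonoidHom.range_eq_map, ← closure_neg_one_indexTwoUnit_eq_top_of_isCyclic,
    MonoidHom.map_closure, Set.image_pair, hneg, map_indexTwoUnit hα hC hG]

end UnitsOfIsCyclic

end BurnsideRing

end

theorem theorem6p5_general {G : Type u} [Group G] [Finite G] {C : Type v} [Group C] [IsCyclic C]
    (hC : Nat.card C = Nat.card G) (hG : IsSeminilpotent 2 1 G) :
    ∃ α : BurnsideRing C →+* BurnsideRing G,
      IsFrobeniusWielandt α ∧
      (∀ β : BurnsideRing C →+* BurnsideRing G, IsFrobeniusWielandt β → β = α) ∧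
      (Units.map (α : BurnsideRing C →* BurnsideRing G)).range ≤
        (BurnsideRing.partialRing (Nsub G) (isCollection_Nsub G)).toSubmonoid.units ∧
      ∃ v : (BurnsideRing G)ˣ,
        (v : BurnsideRing G) =
          ∏ N ∈ (Set.toFinite {N : Subgroup G | N.index = 2}).toFinset, uElem N ∧
        (Units.map (α : BurnsideRing C →* BurnsideRing G)).range =
          Subgroup.closure {-1, v} := by
  have : Finite C := Nat.finite_of_card_ne_zero (hC ▸ Nat.card_pos.ne')
  have hα := BurnsideRing.isFrobeniusWielandt_frobeniusWielandt hC
  have hrange := BurnsideRing.range_units_map hα hC hG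
  exact ⟨BurnsideRing.frobeniusWielandt hC, hα,
    fun _ hβ => BurnsideRing.eq_of_isFrobeniusWielandt hC hβ hα,
    hrange.trans_le BurnsideRing.closure_neg_one_indexTwoUnit_le_units_partialRing,
    BurnsideRing.indexTwoUnit G, rfl, hrange⟩

theorem theorem6p5 {G : Type u} [Group G] [Finite G] {C : Type v} [Group C] [IsCyclic C]
    (hC : Nat.card C = Nat.card G) (heven : Even (Nat.card G)) (hG : IsSeminilpotent 2 1 G) :
    ∃ α : BurnsideRing C →+* BurnsideRing G,
      IsFrobeniusWielandt α ∧
      (∀ β : BurnsideRing C →+* BurnsideRing G, IsFrobeniusWielandt β → β = α) ∧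
      (Units.map (α : BurnsideRing C →* BurnsideRing G)).range ≤
        (BurnsideRing.partialRing (Nsub G) (isCollection_Nsub G)).toSubmonoid.units ∧
      ∃ v : (BurnsideRing G)ˣ,
        (v : BurnsideRing G) =
          ∏ N ∈ (Set.toFinite {N : Subgroup G | N.index = 2}).toFinset, uElem N ∧
        (Units.map (α : BurnsideRing C →* BurnsideRing G)).range =
          Subgroup.closure {-1, v} :=
  theorem6p5_general hC hG
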